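/- Let $K$ be an algebraically closed field and $R$ a finite-dimensional $K$-algebra. The Ext quiver $\mathrm{Ext}_R$ of $R$ is the directed graph whose vertices are the isomorphism classes of simple $R$-modules, with an arrow $x\to y$ iff $\mathrm{Ext}^1_R(S_x,S_y)\neq 0$, where $S_x,S_y$ are simple modules in the classes $x,y$. Suppose that $\mathrm{Ext}_R$ is acyclic, i.e. its underlying undirected graph has no cycles; loops, and pairs of opposite arrows $x\to y$, $y\to x$, count as cycles. Let $M$ be an indecomposable (so nonzero) $R$-module that is multiplicity free, i.e. $M$ has a composition series and its composition factors are pairwise non-isomorphic. Let $\Lambda$ be the lattice of submodules of $M$, and let $\mathrm{Supp}\,M$ be the set of isomorphism classes of composition factors of $M$. For submodules $B\subseteq A$ of $M$ write $[A,B]$ for the corresponding interval of $\Lambda$, and let $\equiv$ be the smallest equivalence relation on the set of intervals with $[A+B,B]\equiv[A,A\cap B]$ for all $A,B\in\Lambda$. A simple lattice factor of $\Lambda$ is the $\equiv$-class of an interval $[A,B]$ such that $A$ covers $B$. The graph $\mathrm{Ext}_\Lambda$ is the directed graph whose vertices are the simple lattice factors of $\Lambda$, with an arrow $x\to y$ iff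 there are $W\subset V\subset U$ in $\Lambda$ such that $U$ covers $V$, $V$ covers $W$, $V$ is the only element of $\Lambda$ strictly between $W$ and $U$, $[U,V]$ has class $x$, and $[V,W]$ has class $y$. Then $\mathrm{Ext}_\Lambda$ is the subgraph of $\mathrm{Ext}_R$ induced by $\mathrm{Supp}\,M$. That is, sending the class of $[A,B]$, where $A$ covers $B$, to the isomorphism class of $A/B$ is a well-defined bijection $\varphi$ from the set of simple lattice factors of $\Lambda$ onto $\mathrm{Supp}\,M$, and for all simple lattice factors $x,y$ there is an arrow $x\to y$ in $\mathrm{Ext}_\Lambda$ iff there is an arrow $\varphi(x)\to\varphi(y)$ in $\mathrm{Ext}_R$. -/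

import Mathlib

universe u v w

namespace MultFree

section LatticeSide

variable (L : Type v) [Lattice L]

/-- An interval `[A, B]` with `B ≤ A` is a `NonemptyInterval L` with `snd = A` and `fst = B`.
`Transposed` relates `[a ⊔ b, b]` to `[a, a ⊓ b]`. -/
inductive Transposed : NonemptyInterval L → NonemptyInterval L → Prop
  | mk (a b : L) :
      Transposed ⟨(b, a ⊔ b), le_sup_right⟩ ⟨(a ⊓ b, a), inf_le_left⟩

/-- The smallest equivalence relation on intervals with `[a ⊔ b, b] ≡ [a, a ⊓ b]`. -/
def intervalSetoid : Setoid (NonemptyInterval L) :=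
  Relation.EqvGen.setoid (Transposed L)

/-- Simple lattice factors: the equivalence classes of the intervals `[A, B]` in which `A`
covers `B`. -/
def SimpleFactor : Type v :=
  {q : Quotient (intervalSetoid L) //
    ∃ I : NonemptyInterval L, I.fst ⋖ I.snd ∧ Quotient.mk (intervalSetoid L) I = q}

variable {L}

/-- The simple lattice factor of `[A, B]`, where `A` covers `B`. -/
def factor {B A : L} (h : B ⋖ A) : SimpleFactor L :=
  ⟨Quotient.mk (intervalSetoid L) ⟨(B, A), h.le⟩, ⟨(B, A), h.le⟩, h, rfl⟩

variable (L)

/-- The Ext graph of a (modular) lattice: there is an arrow `x → y` iff there is an interval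
`[U, W]` of length two, `W ⋖ V ⋖ U`, in which `V` is the only element strictly between `W` and
`U`, with `[U, V]` of class `x` (the top) and `[V, W]` of class `y` (the bottom). -/
def latticeExtGraph : Digraph (SimpleFactor L) where
  Adj x y := ∃ (W V U : L) (hWV : W ⋖ V) (hVU : V ⋖ U),
    (∀ V' : L, W < V' → V' < U → V' = V) ∧ factor hVU = x ∧ factor hWV = y

end LatticeSide

section RingSide

variable (R : Type u) [Ring R]

/-- Isomorphism of simple left `R`-modules. Every simple `R`-module is a quotient of `R`, so the
modules in the universe of `R` represent all of them. -/
def simpleSetoid : Setoid {S : ModuleCat.{u} R // IsSimpleModule R S} where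
  r S T := Nonempty (S.1 ≃ₗ[R] T.1)
  iseqv :=
    { refl := fun _ => ⟨LinearEquiv.refl R _⟩
      symm := fun ⟨e⟩ => ⟨e.symm⟩
      trans := fun ⟨e⟩ ⟨f⟩ => ⟨e.trans f⟩ }

/-- Isomorphism classes of simple left `R`-modules. -/
def SimpleClass : Type (u + 1) := Quotient (simpleSetoid R)

variable {R}

/-- The isomorphism class of a simple module. -/
def SimpleClass.mk (S : ModuleCat.{u} R) (hS : IsSimpleModule R S) : SimpleClass R :=
  Quotient.mk (simpleSetoid R) ⟨S, hS⟩

/-- The module `N` (in any universe) belongs to the isomorphism class `x`. -/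
def SimpleClass.Contains (x : SimpleClass R) (N : Type w) [AddCommGroup N] [Module R N] : Prop :=
  ∃ (S : ModuleCat.{u} R) (hS : IsSimpleModule R S),
    SimpleClass.mk S hS = x ∧ Nonempty (S ≃ₗ[R] N)

variable (R)

/-- The Ext quiver of `R`, as a digraph: the vertices are the isomorphism classes of simple
modules, and there is an arrow from the class of `S` to the class of `T` iff
`Ext¹_R(S, T) ≠ 0`. -/
def extGraph : Digraph (SimpleClass R) where
  Adj x y := ∃ (S T : ModuleCat.{u} R) (hS : IsSimpleModule R S) (hT : IsSimpleModule R T),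
    SimpleClass.mk S hS = x ∧ SimpleClass.mk T hT = y ∧
      Nontrivial (CategoryTheory.Abelian.Ext.{u} S T 1)

end RingSide

section Digraphs

variable {V : Type w}

/-- The underlying undirected graph of `G` has no cycles. Loops and pairs of opposite arrows
`x → y`, `y → x` are cycles (of length one and two) of the underlying graph; they are invisible in
the simple graph and are excluded by the first condition. -/
def IsAcyclicQuiver (G : Digraph V) : Prop :=
  (∀ x y, G.Adj x y → ¬ G.Adj y x) ∧ G.toSimpleGraphInclusive.IsAcyclic

/-- The subgraph of `G` induced by a set `H` of vertices. -/
def inducedSubgraph (G : Digraph V) (H : Set V) : Digraph H where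
  Adj x y := G.Adj x.1 y.1

end Digraphs

section Modules

variable (R : Type u) [Ring R] (M : Type v) [AddCommGroup M] [Module R M]

/-- `M` is nonzero and is not the direct sum of two nonzero submodules. -/
def IsIndecomposable : Prop :=
  Nontrivial M ∧ ∀ A B : Submodule R M, IsCompl A B → A = ⊥ ∨ B = ⊥

variable {R M}

/-- The factor module `A / B` for submodules `B ≤ A` of `M`. -/
abbrev Factor (B A : Submodule R M) : Type v := A ⧸ B.submoduleOf A

variable (R M)

/-- `M` has a composition series (so it has finite length), and the factors of this series are
pairwise non-isomorphic. By the Jordan–Hölder theorem the series does not matter. -/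
def IsMultiplicityFree : Prop :=
  ∃ s : CompositionSeries (Submodule R M), s.head = ⊥ ∧ s.last = ⊤ ∧
    ∀ i j : Fin s.length,
      Nonempty (Factor (s i.castSucc) (s i.succ) ≃ₗ[R] Factor (s j.castSucc) (s j.succ)) → i = j

/-- The support of `M`: the isomorphism classes of the composition factors of `M`. -/
def supp : Set (SimpleClass R) :=
  {x | ∃ s : CompositionSeries (Submodule R M), s.head = ⊥ ∧ s.last = ⊤ ∧
    ∃ i : Fin s.length, x.Contains (Factor (s i.castSucc) (s i.succ))}

end Modules

end MultFree

/-! By the second isomorphism theorem the class of a cover determines the isomorphism type of its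
factor module. Conversely, every cover is projective to a step of a composition series
(`exists_factor_eq_step`), and these steps are pairwise non-isomorphic, so the isomorphism type
determines the class; this gives the bijection `φ`. A length-two interval with a single middle term
is a nonsplit extension, so `φ` carries arrows to arrows (`nontrivial_ext_of_covBy`).

For the converse, indecomposability makes the lattice graph connected: a union of connected
components and its complement would cut out complementary submodules (`mem_of_closed`). A connected
graph embedded in a forest is an induced subgraph, because paths in a forest are unique
(`adj_of_isAcyclic`); the absence of opposite arrows then fixes the direction. -/

namespace MultFree

/-! ### Simple factors and connectedness in modular lattices -/

section LatticeLemmas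

variable {L : Type v} [Lattice L]

theorem factor_eq_of_transpose {a b c d : L} (h : b ⋖ d) (h' : c ⋖ a) (hsup : a ⊔ b = d)
    (hinf : a ⊓ b = c) : factor h = factor h' := by
  subst hsup hinf
  exact Subtype.ext (Quotient.sound (Relation.EqvGen.rel _ _ (Transposed.mk a b)))

theorem exists_factor_eq (x : SimpleFactor L) : ∃ (B A : L) (h : B ⋖ A), factor h = x := by
  obtain ⟨_, ⟨⟨⟨B, A⟩, hBA⟩, h, rfl⟩⟩ := x
  exact ⟨B, A, h, rfl⟩

variable [IsModularLattice L]

theorem inf_covBy_of_covBy_of_sup {a b d : L} (h : b ⋖ d) (hsup : a ⊔ b = d) : a ⊓ b ⋖ a := by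
  subst hsup
  exact inf_covBy_of_covBy_sup_right h

/-- A class in `T` slides down to `C` past classes outside `T`. For `W ⋖ V ⋖ U` with only the upper
class in `T`, a unique middle term would be an arrow leaving `T`. So there is a second middle term
`V'`, and `[V', W]` is a transpose of `[U, V]`, hence of the same class but one step lower. -/
theorem exists_covBy_factor_mem [WellFoundedLT L] [IsStronglyCoatomic L] {T : Set (SimpleFactor L)}
    (hT : ∀ x y, (latticeExtGraph L).Adj x y → x ∈ T → y ∈ T) {C : L} (V : L) :
    ∀ {U : L}, C ≤ V → ∀ hVU : V ⋖ U, factor hVU ∈ T →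
    (∀ (B A : L) (h : B ⋖ A), C ≤ B → A ≤ V → factor h ∉ T) →
    ∃ (U' : L) (h : C ⋖ U'), factor h ∈ T := by
  induction V using WellFoundedLT.induction with
  | ind V ih =>
    intro U hCV hVU hmem hV
    rcases hCV.eq_or_lt with rfl | hlt
    · exact ⟨U, hVU, hmem⟩
    obtain ⟨W, hCW, hWV⟩ := exists_le_covBy_of_lt hlt
    have hW : factor hWV ∉ T := hV _ _ hWV hCW le_rfl
    have hne : ¬ ∀ V' : L, W < V' → V' < U → V' = V := fun huniq =>
      hW (hT _ _ ⟨W, V, U, hWV, hVU, huniq, rfl, rfl⟩ hmem)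
    push Not at hne
    obtain ⟨V', hWV', hV'U, hne⟩ := hne
    have hnle : ¬ V' ≤ V := fun hle => (hle.lt_of_ne hne).not_ge
      (by
        rcases hWV.eq_or_eq hWV'.le hle with h | h
        · exact absurd h hWV'.ne'
        · exact h.ge)
    have hsup : V' ⊔ V = U := by
      rcases hVU.eq_or_eq le_sup_right (sup_le hV'U.le hVU.le) with h | h
      · exact absurd (h ▸ le_sup_left) hnle
      · exact h
    have hnle' : ¬ V ≤ V' := fun hle => hV'U.ne ((sup_eq_left.2 hle).symm.trans hsup)
    have hinf : V' ⊓ V = W := by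
      rcases hWV.eq_or_eq (le_inf hWV'.le hWV.le) inf_le_right with h | h
      · exact h
      · exact absurd (h ▸ inf_le_left) hnle'
    have hcov : W ⋖ V' := hinf ▸ inf_covBy_of_covBy_of_sup hVU hsup
    refine ih W hWV.lt hCW hcov ?_ fun B A h hCB hAW => hV B A h hCB (hAW.trans hWV.le)
    rwa [← factor_eq_of_transpose hVU hcov hsup hinf]

/-- The covers inside `[⊥, U]` have the factors of the covers inside `[⊥, A]` and that of
`[U, A]`. -/
theorem factor_mem_of_covBy {T : Set (SimpleFactor L)} {A U : L} (hAU : A ⋖ U)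
    (hmem : factor hAU ∈ T) (hA : ∀ (b a : L) (h : b ⋖ a), a ≤ A → factor h ∈ T)
    {b a : L} (h : b ⋖ a) (ha : a ≤ U) : factor h ∈ T := by
  by_cases haA : a ≤ A
  · exact hA b a h haA
  have hsup : a ⊔ A = U := by
    rcases hAU.eq_or_eq le_sup_right (sup_le ha hAU.le) with h | h
    · exact absurd (h ▸ le_sup_left) haA
    · exact h
  by_cases hbA : b ≤ A
  · have hinf : a ⊓ A = b := by
      rcases h.eq_or_eq (le_inf h.le hbA) inf_le_left with h | h
      · exact h
      · exact absurd (inf_eq_left.1 h) haA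
    rwa [← factor_eq_of_transpose hAU h hsup hinf]
  · have hsup' : b ⊔ A = U := by
      rcases hAU.eq_or_eq le_sup_right (sup_le (h.le.trans ha) hAU.le) with h | h
      · exact absurd (h ▸ le_sup_left) hbA
      · exact h
    -- Here `b` and `a` both join with `A` to `U`, so by modularity the cover is a transpose of one
    -- with top `a ⊓ A`, inside `[⊥, A]`.
    have hs : (a ⊓ A) ⊔ b = a := by
      rw [sup_comm, inf_comm, ← sup_inf_assoc_of_le _ h.le, hsup', inf_eq_right.2 ha]
    have hc := inf_covBy_of_covBy_of_sup h hs
    rw [factor_eq_of_transpose h hc hs rfl]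
    exact hA _ _ hc inf_le_right

/-- If the top has no nontrivial complements then the lattice Ext graph is connected. -/
theorem mem_of_closed [BoundedOrder L] [WellFoundedLT L] [WellFoundedGT L]
    (hind : ∀ A B : L, IsCompl A B → A = ⊥ ∨ B = ⊥) {T : Set (SimpleFactor L)}
    (hT : ∀ x y, (latticeExtGraph L).Adj x y → (x ∈ T ↔ y ∈ T)) {x : SimpleFactor L}
    (hx : x ∈ T) (y : SimpleFactor L) : y ∈ T := by
  have key (T : Set (SimpleFactor L)) : ∃ A : L,
      (∀ (b a : L) (h : b ⋖ a), a ≤ A → factor h ∈ T) ∧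
      ∀ (U : L) (h : A ⋖ U), factor h ∉ T := by
    obtain ⟨A, hA, hmax⟩ := WellFounded.has_min (wellFounded_gt (α := L))
      {A | ∀ (b a : L) (h : b ⋖ a), a ≤ A → factor h ∈ T}
      ⟨⊥, fun b a h ha => absurd h.lt (by simp [le_bot_iff.1 ha])⟩
    exact ⟨A, hA, fun U h hU => hmax U (fun _ _ => factor_mem_of_covBy h hU hA) h.lt⟩
  have main (T : Set (SimpleFactor L)) (A B U : L)
      (hT : ∀ x y, (latticeExtGraph L).Adj x y → x ∈ T → y ∈ T)
      (hA : ∀ (U : L) (h : A ⋖ U), factor h ∉ T)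
      (hB : ∀ (b a : L) (h : b ⋖ a), a ≤ B → factor h ∉ T)
      (hU : A ⊔ B ⋖ U) : factor hU ∉ T := by
    intro hmem
    -- Modularity moves each cover inside `[A, A ⊔ B]` to a cover below `B`, whose class is outside
    -- `T`; so the class of `hU` can slide down to `A`.
    obtain ⟨U', h, hU'⟩ := exists_covBy_factor_mem hT _ le_sup_left hU hmem (by
      intro b a h hAb ha
      have hs : (a ⊓ B) ⊔ b = a := by
        apply le_antisymm (sup_le inf_le_left h.le)
        calc a = (A ⊔ B) ⊓ a := (inf_eq_right.2 ha).symm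
          _ = A ⊔ B ⊓ a := sup_inf_assoc_of_le _ (hAb.trans h.le)
          _ ≤ _ := sup_le (hAb.trans le_sup_right) (by rw [inf_comm]; exact le_sup_left)
      have hc := inf_covBy_of_covBy_of_sup h hs
      rw [factor_eq_of_transpose h hc hs rfl]
      exact hB _ _ hc inf_le_right)
    exact hA U' h hU'
  -- `A` and `B` are maximal with all classes below them in `T`, respectively outside `T`; they turn
  -- out to be complements.
  obtain ⟨A, hA, hA'⟩ := key T
  obtain ⟨B, hB, hB'⟩ := key Tᶜ
  have hdisj : A ⊓ B = ⊥ := by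
    by_contra hne
    obtain ⟨a, ha, hle⟩ := exists_covBy_le_of_lt (bot_lt_iff_ne_bot.2 hne)
    exact hB _ _ ha (hle.trans inf_le_right) (hA _ _ ha (hle.trans inf_le_left))
  have hcod : A ⊔ B = ⊤ := by
    by_contra hne
    obtain ⟨U, hU, -⟩ := exists_covBy_le_of_lt (lt_top_iff_ne_top.2 hne)
    have h₁ := main T A B U (fun x y h => (hT x y h).1) hA' hB hU
    have h₂ := main Tᶜ B A U (fun x y h hx hy => hx ((hT x y h).2 hy)) hB'
      (fun b a h ha hn => hn (hA b a h ha)) (sup_comm A B ▸ hU)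
    apply h₂
    convert h₁ using 3
    exact sup_comm B A
  rcases hind A B ⟨disjoint_iff.2 hdisj, codisjoint_iff.2 hcod⟩ with rfl | rfl
  · obtain ⟨b, a, h, rfl⟩ := exists_factor_eq x
    exact absurd hx (hB b a h (by simp_all))
  · obtain ⟨b, a, h, rfl⟩ := exists_factor_eq y
    exact hA b a h (by simp_all)

/-- In the lattice Jordan–Hölder theorem, every cover is projective to a step of any chain
of covers from `⊥` to `⊤`. -/
theorem exists_factor_eq_step [BoundedOrder L] {n : ℕ} (s : Fin (n + 1) → L)
    (hs : ∀ i : Fin n, s i.castSucc ⋖ s i.succ) (h0 : s 0 = ⊥) (hn : s (Fin.last n) = ⊤)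
    {B A : L} (h : B ⋖ A) : ∃ i : Fin n, factor h = factor (hs i) := by
  -- The step sought is the one at which `s i ⊓ A` first fails to lie below `B`. With `X` its upper
  -- intersection, both covers are transposes of the same interval `[X, X ⊓ B]`.
  have hex : ∃ i : Fin n, s i.castSucc ⊓ A ≤ B ∧ ¬ s i.succ ⊓ A ≤ B := by
    by_contra! hcon
    have : ∀ i : Fin (n + 1), s i ⊓ A ≤ B := by
      intro i
      induction i using Fin.induction with
      | zero => simp [h0]
      | succ i ih => exact hcon i ih
    exact h.lt.not_ge (by simpa [hn] using this (Fin.last n))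
  obtain ⟨i, hi, hi'⟩ := hex
  refine ⟨i, ?_⟩
  set X := s i.succ ⊓ A with hX
  have hXB : X ⊔ B = A := by
    rcases h.eq_or_eq le_sup_right (sup_le inf_le_right h.le) with h | h
    · exact absurd (h ▸ le_sup_left) hi'
    · exact h
  have hXs : X ⊔ s i.castSucc = s i.succ := by
    rcases (hs i).eq_or_eq le_sup_right (sup_le inf_le_left (hs i).le) with h | h
    · refine absurd ?_ hi'
      exact (le_inf (h ▸ le_sup_left) inf_le_right).trans hi
    · exact h
  have h₁ := inf_covBy_of_covBy_of_sup h hXB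
  have h₂ := inf_covBy_of_covBy_of_sup (hs i) hXs
  have heq : X ⊓ B = X ⊓ s i.castSucc := by
    have hle : X ⊓ s i.castSucc ≤ X ⊓ B :=
      le_inf inf_le_left ((le_inf inf_le_right (inf_le_left.trans inf_le_right)).trans hi)
    exact (h₂.eq_or_eq hle inf_le_left).resolve_right h₁.ne
  rw [factor_eq_of_transpose h h₁ hXB rfl,
    factor_eq_of_transpose (hs i) (heq ▸ h₂ : X ⊓ B ⋖ X) hXs heq.symm]

end LatticeLemmas

/-! ### Connected graphs inside forests -/

section GraphLemmas

/-- A connected graph that maps injectively into a forest is an induced subgraph of it. -/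
theorem adj_of_isAcyclic {V : Type v} {V' : Type w} {G : SimpleGraph V} {G' : SimpleGraph V'}
    (f : G →g G') (hf : Function.Injective f) (hG : G.Preconnected) (hG' : G'.IsAcyclic)
    {x y : V} (h : G'.Adj (f x) (f y)) : G.Adj x y := by
  obtain ⟨p, hp⟩ := (hG x y).exists_isPath
  -- The image of a path is again a path by injectivity, so it must be the single edge `h`.
  have := (hG'.subsingleton_path _ _).elim ⟨p.map f, hp.map hf⟩ (SimpleGraph.Path.singleton h)
  have hlen : (p.map f).length = 1 := by
    rw [congrArg (fun q : G'.Path _ _ => q.1.length) this]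
    rfl
  rw [SimpleGraph.Walk.length_map] at hlen
  exact p.adj_of_length_eq_one hlen

end GraphLemmas
end MultFree

namespace MultFree

open CategoryTheory

/-! ### Nonsplit extensions from lattice intervals -/

section ExtLemmas

variable {R : Type u} [Ring R]

/-- If `Ext¹(Q, N) = 0` then every extension of `Q` by `N` splits. -/
theorem exists_section_of_subsingleton_ext {N E Q : Type u} [AddCommGroup N] [Module R N]
    [AddCommGroup E] [Module R E] [AddCommGroup Q] [Module R Q] (f : N →ₗ[R] E) (g : E →ₗ[R] Q)
    (hf : Function.Injective f) (hg : Function.Surjective g) (hfg : Function.Exact f g)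
    (hext : Subsingleton (Abelian.Ext.{u} (ModuleCat.of R Q) (ModuleCat.of R N) 1)) :
    ∃ s : Q →ₗ[R] E, ∀ q, g (s q) = q := by
  let S : ShortComplex (ModuleCat.{u} R) :=
    ShortComplex.mk (ModuleCat.ofHom f) (ModuleCat.ofHom g) (by
      ext x; exact hfg.apply_apply_eq_zero x)
  have hS : S.ShortExact :=
    { exact := (ShortComplex.ShortExact.moduleCat_exact_iff_function_exact S).2 hfg
      mono_f := (ModuleCat.mono_iff_injective _).2 hf
      epi_g := (ModuleCat.epi_iff_surjective _).2 hg }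
  -- The obstruction to lifting the identity of `Q` along `g` lies in `Ext¹(Q, N) = 0`.
  obtain ⟨x, hx⟩ := Abelian.Ext.covariant_sequence_exact₃ S.X₃ hS
    (Abelian.Ext.mk₀ (𝟙 S.X₃)) (zero_add 1) (Subsingleton.elim (α :=
      Abelian.Ext.{u} (ModuleCat.of R Q) (ModuleCat.of R N) 1) _ _)
  obtain ⟨s, rfl⟩ := (Abelian.Ext.mk₀_bijective _ _).2 x
  rw [Abelian.Ext.mk₀_comp_mk₀] at hx
  have hs : s ≫ S.g = 𝟙 _ := (Abelian.Ext.mk₀_bijective _ _).1 hx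
  exact ⟨s.hom, fun q => congrArg (fun t : S.X₃ ⟶ S.X₃ => t.hom q) hs⟩

/-- `Ext` is taken between modules in the universe of `R`, while `M` may live elsewhere; the
sequence is transported along `Shrink`. -/
theorem exists_section_of_subsingleton_ext_of_small {N E Q : Type v} [AddCommGroup N] [Module R N]
    [AddCommGroup E] [Module R E] [AddCommGroup Q] [Module R Q] [Small.{u} E]
    (f : N →ₗ[R] E) (g : E →ₗ[R] Q)
    (hf : Function.Injective f) (hg : Function.Surjective g) (hfg : Function.Exact f g)
    {Q' N' : ModuleCat.{u} R} (eQ : Q' ≃ₗ[R] Q) (eN : N' ≃ₗ[R] N)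
    (hext : Subsingleton (Abelian.Ext.{u} Q' N' 1)) :
    ∃ s : Q →ₗ[R] E, ∀ q, g (s q) = q := by
  let eE := Shrink.linearEquiv.{u} R E
  obtain ⟨s, hs⟩ := exists_section_of_subsingleton_ext
    (eE.symm.toLinearMap ∘ₗ f ∘ₗ eN.toLinearMap) (eQ.symm.toLinearMap ∘ₗ g ∘ₗ eE.toLinearMap)
    (eE.symm.injective.comp (hf.comp eN.injective))
    (eQ.symm.surjective.comp (hg.comp eE.surjective))
    (by
      intro x
      have := hfg (eE x)
      simp only [LinearMap.comp_apply, LinearEquiv.coe_coe, LinearEquiv.map_eq_zero_iff, this,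
        Set.mem_range]
      constructor
      · rintro ⟨y, hy⟩
        exact ⟨eN.symm y, by simp [hy]⟩
      · rintro ⟨y, hy⟩
        exact ⟨eN y, by simp [← hy]⟩)
    hext
  refine ⟨eE.toLinearMap ∘ₗ s ∘ₗ eQ.symm.toLinearMap, fun q => ?_⟩
  simpa using congrArg eQ (hs (eQ.symm q))

variable {M : Type v} [AddCommGroup M] [Module R M]

/-- A uniserial interval of length two in the submodule lattice gives a nonsplit extension. -/
theorem nontrivial_ext_of_covBy [IsNoetherian R M] {W V U : Submodule R M} (hWV : W ⋖ V)
    (hVU : V ⋖ U)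
    (huniq : ∀ V' : Submodule R M, W < V' → V' < U → V' = V) {Q' N' : ModuleCat.{u} R}
    (eQ : Q' ≃ₗ[R] Factor V U) (eN : N' ≃ₗ[R] Factor W V) :
    Nontrivial (Abelian.Ext.{u} Q' N' 1) := by
  rw [← not_subsingleton_iff_nontrivial]
  intro hext
  have : Small.{u} (Factor W U) := Module.Finite.small.{u} R _
  let f : Factor W V →ₗ[R] Factor W U :=
    Submodule.mapQ _ _ (Submodule.inclusion hVU.le) (fun x hx => hx)
  let g : Factor W U →ₗ[R] Factor V U :=
    Submodule.mapQ _ _ LinearMap.id (fun x hx => hWV.le hx)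
  have hf : Function.Injective f := by
    rw [injective_iff_map_eq_zero]
    intro x
    obtain ⟨x, rfl⟩ := Submodule.Quotient.mk_surjective _ x
    intro hx
    exact (Submodule.Quotient.mk_eq_zero _).2
      ((Submodule.Quotient.mk_eq_zero (W.submoduleOf U)).1 hx :)
  have hg : Function.Surjective g := by
    intro x
    obtain ⟨x, rfl⟩ := Submodule.Quotient.mk_surjective _ x
    exact ⟨Submodule.Quotient.mk x, rfl⟩
  have hfg : Function.Exact f g := by
    intro x
    obtain ⟨x, rfl⟩ := Submodule.Quotient.mk_surjective _ x
    constructor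
    · intro hx
      have hxV : (x : M) ∈ V := (Submodule.Quotient.mk_eq_zero (V.submoduleOf U)).1 hx
      exact ⟨Submodule.Quotient.mk ⟨x, hxV⟩, rfl⟩
    · rintro ⟨y, hy⟩
      rw [← hy]
      obtain ⟨y, rfl⟩ := Submodule.Quotient.mk_surjective _ y
      exact (Submodule.Quotient.mk_eq_zero (V.submoduleOf U)).2 y.2
  obtain ⟨s, hs⟩ := exists_section_of_subsingleton_ext_of_small f g hf hg hfg eQ eN hext
  -- The preimage in `U` of the image of the section is a complement of `V` in `[W, U]`, which a
  -- unique middle term forbids.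
  let V' : Submodule R M := ((LinearMap.range s).comap (W.submoduleOf U).mkQ).map U.subtype
  have hV'U : V' ≤ U := Submodule.map_subtype_le _ _
  have hWV' : W ≤ V' := fun x hx => ⟨⟨x, hVU.le (hWV.le hx)⟩,
    ⟨0, by
      rw [map_zero]
      exact ((Submodule.Quotient.mk_eq_zero (W.submoduleOf U)).2 hx).symm⟩, rfl⟩
  have hinf : V' ⊓ V ≤ W := by
    rintro _ ⟨⟨x, ⟨q, hq⟩, rfl⟩, hxV⟩
    have hgx : g (Submodule.Quotient.mk x) = 0 :=
      (Submodule.Quotient.mk_eq_zero (V.submoduleOf U)).2 hxV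
    have hq0 : q = 0 := by
      rw [← hs q, hq]
      exact hgx
    rw [hq0, map_zero] at hq
    exact (Submodule.Quotient.mk_eq_zero (W.submoduleOf U)).1 hq.symm
  have hsup : U ≤ V' ⊔ V := by
    intro x hx
    obtain ⟨w, hw⟩ := Submodule.Quotient.mk_surjective _ (s (Submodule.Quotient.mk ⟨x, hx⟩))
    have hw' : (w : M) ∈ V' := ⟨w, ⟨_, hw.symm⟩, rfl⟩
    have hgw := hs (Submodule.Quotient.mk ⟨x, hx⟩)
    rw [← hw] at hgw
    have hsub : (w : M) - x ∈ V := (Submodule.Quotient.eq (V.submoduleOf U)).1 hgw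
    have : x = w - (w - x) := by abel
    rw [this]
    exact sub_mem (Submodule.mem_sup_left hw') (Submodule.mem_sup_right hsub)
  rcases hWV'.eq_or_lt with h | h
  · exact hVU.lt.not_ge (hsup.trans (sup_le (h ▸ hWV.le) le_rfl))
  rcases hV'U.eq_or_lt with h' | h'
  · exact hWV.lt.not_ge ((le_inf (h' ▸ hVU.le) le_rfl).trans hinf)
  · exact hWV.lt.not_ge ((le_inf (huniq V' h h').ge le_rfl).trans hinf)

end ExtLemmas

/-! ### Isomorphism classes of factor modules -/

section ClassLemmas

variable {R : Type u} [Ring R]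

theorem SimpleClass.Contains.congr {x : SimpleClass R} {N : Type v} {N' : Type w} [AddCommGroup N]
    [Module R N] [AddCommGroup N'] [Module R N'] (h : x.Contains N) (e : N ≃ₗ[R] N') :
    x.Contains N' := by
  obtain ⟨S, hS, hx, ⟨e'⟩⟩ := h
  exact ⟨S, hS, hx, ⟨e'.trans e⟩⟩

theorem SimpleClass.Contains.eq {x y : SimpleClass R} {N : Type v} [AddCommGroup N]
    [Module R N] (hx : x.Contains N) (hy : y.Contains N) : x = y := by
  obtain ⟨S, hS, rfl, ⟨e⟩⟩ := hx
  obtain ⟨T, hT, rfl, ⟨e'⟩⟩ := hy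
  exact Quotient.sound ⟨e.trans e'.symm⟩

theorem SimpleClass.Contains.nonempty_linearEquiv {x : SimpleClass R} {N : Type v} {N' : Type w}
    [AddCommGroup N] [Module R N] [AddCommGroup N'] [Module R N'] (h : x.Contains N)
    (h' : x.Contains N') : Nonempty (N ≃ₗ[R] N') := by
  obtain ⟨S, hS, rfl, ⟨e⟩⟩ := h
  obtain ⟨T, hT, hx, ⟨e'⟩⟩ := h'
  obtain ⟨i⟩ : Nonempty (T ≃ₗ[R] S) := Quotient.exact hx
  exact ⟨e.symm.trans (i.symm.trans e')⟩

theorem exists_contains (N : Type v) [AddCommGroup N] [Module R N] [IsSimpleModule R N] :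
    ∃ x : SimpleClass R, x.Contains N := by
  have : Small.{u} N := Module.Finite.small.{u} R _
  exact ⟨_, ModuleCat.of R (Shrink.{u} N), IsSimpleModule.congr (Shrink.linearEquiv.{u} R N), rfl,
    ⟨Shrink.linearEquiv.{u} R N⟩⟩

variable {M : Type v} [AddCommGroup M] [Module R M]

theorem isSimpleModule_factor {B A : Submodule R M} (h : B ⋖ A) : IsSimpleModule R (Factor B A) :=
  (covBy_iff_quot_is_simple h.le).1 h

theorem nonempty_linearEquiv_of_eqvGen {I J : NonemptyInterval (Submodule R M)}
    (h : Relation.EqvGen (Transposed (Submodule R M)) I J) :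
    Nonempty (Factor I.fst I.snd ≃ₗ[R] Factor J.fst J.snd) := by
  induction h with
  | rel I J h =>
    obtain ⟨a, b⟩ := h
    have e : (a ⊓ b).submoduleOf a = a.submoduleOf a ⊓ b.submoduleOf a :=
      Submodule.comap_inf _ _ _
    exact ⟨((Submodule.quotEquivOfEq _ _ e).trans
      (LinearMap.quotientInfEquivSupQuotient a b)).symm⟩
  | refl => exact ⟨LinearEquiv.refl _ _⟩
  | symm _ _ _ ih => exact ih.map LinearEquiv.symm
  | trans _ _ _ _ _ ih₁ ih₂ => exact ⟨ih₁.some.trans ih₂.some⟩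

theorem nonempty_linearEquiv_of_factor_eq {B A B' A' : Submodule R M} {h : B ⋖ A} {h' : B' ⋖ A'}
    (he : factor h = factor h') : Nonempty (Factor B A ≃ₗ[R] Factor B' A') :=
  nonempty_linearEquiv_of_eqvGen
    (I := ⟨(B, A), h.le⟩) (J := ⟨(B', A'), h'.le⟩) (Quotient.exact (congrArg Subtype.val he))

end ClassLemmas
end MultFree

namespace MultFree

/-! ### Lattice classes versus composition factors -/

section Support

variable {R : Type u} [Ring R] {M : Type v} [AddCommGroup M] [Module R M]

theorem isNoetherian_and_isArtinian (hmf : IsMultiplicityFree R M) :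
    IsNoetherian R M ∧ IsArtinian R M := by
  obtain ⟨s, h0, h1, -⟩ := hmf
  exact isFiniteLength_iff_isNoetherian_isArtinian.1
    (isFiniteLength_iff_exists_compositionSeries.2 ⟨s, h0, h1⟩)

/-- Every cover in the submodule lattice has the class of a step of a given composition series. -/
theorem exists_factor_eq_compositionSeries (s : CompositionSeries (Submodule R M))
    (h0 : s.head = ⊥) (h1 : s.last = ⊤) {B A : Submodule R M} (h : B ⋖ A) :
    ∃ (i : Fin s.length) (hi : s i.castSucc ⋖ s i.succ), factor h = factor hi := by
  obtain ⟨i, hi⟩ := exists_factor_eq_step (fun i => s i) (fun i => s.step i) h0 h1 h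
  exact ⟨i, _, hi⟩

/-- In a multiplicity free module, covers with isomorphic factor modules have the same class. -/
theorem factor_eq_of_linearEquiv (hmf : IsMultiplicityFree R M) {B A B' A' : Submodule R M}
    (h : B ⋖ A) (h' : B' ⋖ A') (e : Factor B A ≃ₗ[R] Factor B' A') : factor h = factor h' := by
  obtain ⟨s, h0, h1, hs⟩ := hmf
  obtain ⟨i, hi, hhi⟩ := exists_factor_eq_compositionSeries s h0 h1 h
  obtain ⟨j, hj, hhj⟩ := exists_factor_eq_compositionSeries s h0 h1 h'
  obtain ⟨ei⟩ := nonempty_linearEquiv_of_factor_eq hhi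
  obtain ⟨ej⟩ := nonempty_linearEquiv_of_factor_eq hhj
  obtain rfl := hs i j ⟨ei.symm.trans (e.trans ej)⟩
  exact hhi.trans hhj.symm

/-- The bijection between the simple factors of the submodule lattice of a multiplicity free
module and its support. -/
theorem exists_equiv_supp (hmf : IsMultiplicityFree R M) :
    ∃ φ : SimpleFactor (Submodule R M) ≃ supp R M,
      ∀ (B A : Submodule R M) (h : B ⋖ A), (φ (factor h)).1.Contains (Factor B A) := by
  have hex (q : SimpleFactor (Submodule R M)) : ∃ x : supp R M,
      ∀ (B A : Submodule R M) (h : B ⋖ A), factor h = q → x.1.Contains (Factor B A) := by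
    obtain ⟨s, h0, h1, -⟩ := hmf
    obtain ⟨B, A, h, rfl⟩ := exists_factor_eq q
    obtain ⟨i, hi, hhi⟩ := exists_factor_eq_compositionSeries s h0 h1 h
    have := isSimpleModule_factor h
    obtain ⟨x, hx⟩ := exists_contains (R := R) (Factor B A)
    obtain ⟨e⟩ := nonempty_linearEquiv_of_factor_eq hhi
    refine ⟨⟨x, s, h0, h1, i, hx.congr e⟩, fun B' A' h' hh' => ?_⟩
    obtain ⟨e'⟩ := nonempty_linearEquiv_of_factor_eq hh'
    exact hx.congr e'.symm
  choose f hf using hex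
  have hfac (B A : Submodule R M) (h : B ⋖ A) : (f (factor h)).1.Contains (Factor B A) :=
    hf _ B A h rfl
  refine ⟨Equiv.ofBijective f ⟨fun p q hpq => ?_, fun x => ?_⟩, hfac⟩
  · obtain ⟨B, A, h, rfl⟩ := exists_factor_eq p
    obtain ⟨B', A', h', rfl⟩ := exists_factor_eq q
    have hB := hfac B A h
    rw [hpq] at hB
    obtain ⟨e⟩ := hB.nonempty_linearEquiv (hfac B' A' h')
    exact factor_eq_of_linearEquiv hmf h h' e
  · obtain ⟨x, s, h0, h1, i, hx⟩ := x
    have hi : s i.castSucc ⋖ s i.succ := s.step i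
    exact ⟨factor hi, Subtype.ext ((hfac _ _ hi).eq hx)⟩

/-- The lattice Ext graph of the submodule lattice maps to the Ext quiver of the ring. -/
theorem extGraph_adj_of_latticeExtGraph_adj [IsNoetherian R M]
    {φ : SimpleFactor (Submodule R M) → SimpleClass R}
    (hφ : ∀ (B A : Submodule R M) (h : B ⋖ A), (φ (factor h)).Contains (Factor B A))
    {x y : SimpleFactor (Submodule R M)} (h : (latticeExtGraph (Submodule R M)).Adj x y) :
    (extGraph R).Adj (φ x) (φ y) := by
  obtain ⟨W, V, U, hWV, hVU, huniq, rfl, rfl⟩ := h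
  obtain ⟨S, hS, hSx, ⟨eS⟩⟩ := hφ V U hVU
  obtain ⟨T, hT, hTx, ⟨eT⟩⟩ := hφ W V hWV
  exact ⟨S, T, hS, hT, hSx, hTx, nontrivial_ext_of_covBy hWV hVU huniq eS eT⟩

end Support

/-- The lattice Ext graph of a lattice without nontrivial complements is connected. -/
theorem latticeExtGraph_preconnected {L : Type v} [Lattice L] [IsModularLattice L] [BoundedOrder L]
    [WellFoundedLT L] [WellFoundedGT L] (hind : ∀ A B : L, IsCompl A B → A = ⊥ ∨ B = ⊥) :
    (latticeExtGraph L).toSimpleGraphInclusive.Preconnected := by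
  intro x
  have hreach (a b) (hab : (latticeExtGraph L).Adj a b) :
      (latticeExtGraph L).toSimpleGraphInclusive.Reachable a b := by
    by_cases h : a = b
    · rw [h]
    · exact SimpleGraph.Adj.reachable ⟨h, Or.inl hab⟩
  -- The connected component of `x` is closed under arrows in both directions.
  exact mem_of_closed hind (T := {z | SimpleGraph.Reachable _ x z})
    (fun a b hab => ⟨fun h => h.trans (hreach a b hab), fun h => h.trans (hreach a b hab).symm⟩)
    (SimpleGraph.Reachable.refl x)

/-- A connected quiver that maps injectively to an acyclic quiver is an induced subquiver. -/
theorem digraph_adj_of_isAcyclicQuiver {V : Type v} {V' : Type w} {G : Digraph V} {G' : Digraph V'}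
    {f : V → V'} (hf : Function.Injective f) (hmap : ∀ x y, G.Adj x y → G'.Adj (f x) (f y))
    (hG : G.toSimpleGraphInclusive.Preconnected) (hG' : IsAcyclicQuiver G') {x y : V}
    (h : G'.Adj (f x) (f y)) : G.Adj x y := by
  have hne : f x ≠ f y := fun he => hG'.1 _ _ h (by rw [he] at h ⊢; exact h)
  let F : G.toSimpleGraphInclusive →g G'.toSimpleGraphInclusive :=
    ⟨f, fun {a b} hab => ⟨hf.ne hab.1, hab.2.imp (hmap a b) (hmap b a)⟩⟩
  have hadj := adj_of_isAcyclic F hf hG hG'.2 (x := x) (y := y) ⟨hne, Or.inl h⟩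
  -- An arrow `y → x` would map to an arrow opposite to `h`.
  exact hadj.2.resolve_right fun hyx => hG'.1 _ _ h (hmap _ _ hyx)

end MultFree

/-- The bijection `φ` is the identification of the simple lattice factors of the submodule lattice
with the composition factors of `M`: it sends the class of `[A, B]` to the class of `A / B`. -/
theorem corollary3p3 {K : Type w} [Field K] [IsAlgClosed K]
    {R : Type u} [Ring R] [Algebra K R] [FiniteDimensional K R]
    (hR : MultFree.IsAcyclicQuiver (MultFree.extGraph R))
    {M : Type v} [AddCommGroup M] [Module R M]
    (hM : MultFree.IsIndecomposable R M) (hmf : MultFree.IsMultiplicityFree R M) :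
    ∃ φ : MultFree.SimpleFactor (Submodule R M) ≃ MultFree.supp R M,
      (∀ (B A : Submodule R M) (h : B ⋖ A),
        (φ (MultFree.factor h)).1.Contains (MultFree.Factor B A)) ∧
      ∀ x y : MultFree.SimpleFactor (Submodule R M),
        (MultFree.latticeExtGraph (Submodule R M)).Adj x y ↔
          (MultFree.inducedSubgraph (MultFree.extGraph R) (MultFree.supp R M)).Adj (φ x) (φ y) := by
  obtain ⟨_, _⟩ := MultFree.isNoetherian_and_isArtinian hmf
  obtain ⟨φ, hφ⟩ := MultFree.exists_equiv_supp hmf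
  have hmap (x y) (h : (MultFree.latticeExtGraph (Submodule R M)).Adj x y) :
      (MultFree.extGraph R).Adj (φ x).1 (φ y).1 :=
    MultFree.extGraph_adj_of_latticeExtGraph_adj (φ := fun x => (φ x).1) hφ h
  exact ⟨φ, hφ, fun x y => ⟨hmap x y, fun h =>
    MultFree.digraph_adj_of_isAcyclicQuiver (f := fun x => (φ x).1)
      (Subtype.val_injective.comp φ.injective) hmap
      (MultFree.latticeExtGraph_preconnected hM.2) hR h⟩⟩
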